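/- Let $\rho$ be a quantum state on a $d$-dimensional Hilbert space, i.e. a positive semidefinite complex $d\times d$ matrix (the density matrix in a fixed reference basis) with $\mathrm{Tr}\,\rho=1$. Let $\rho^*$ be its entrywise complex conjugate, $\mathrm{Re}(\rho)=\frac12(\rho+\rho^*)$, and let $\mathcal R$ be the set of real states (states all of whose entries are real). Put $$M_{\mathrm{Re}}(\rho)=1-F(\rho,\mathrm{Re}(\rho)),\qquad F(\rho,\sigma)=\mathrm{Tr}\sqrt{\sqrt\rho\,\sigma\sqrt\rho},$$ $$M_{\mathrm{tr}}(\rho)=\min_{\sigma\in\mathcal R}\|\rho-\sigma\|_{\mathrm{tr}},\qquad \|A\|_{\mathrm{tr}}=\mathrm{Tr}\sqrt{A^\dagger A},\qquad P(\rho)=\mathrm{Tr}(\rho^2).$$ Then $(d-1)^2-(d-1)M_{\mathrm{tr}}(\rho)^2\ge 0$ and $$1-\left[\frac1d+\frac1d\sqrt{(d-1)^2-(d-1)M_{\mathrm{tr}}(\rho)^2}\right]^{1/2}\le M_{\mathrm{Re}}(\rho)\le 1-\Big(\max\{0,\;P(\rho)-M_{\mathrm{tr}}(\rho)^2\}\Big)^{1/2}.$$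 In particular, whenever $P(\rho)\ge M_{\mathrm{tr}}(\rho)^2$, one has $M_{\mathrm{Re}}(\rho)\le 1-\big(P(\rho)-M_{\mathrm{tr}}(\rho)^2\big)^{1/2}$. -/

import Mathlib

noncomputable section

namespace Imaginarity

open scoped ComplexOrder MatrixOrder Matrix

/-- A quantum state on a `d`-dimensional Hilbert space, given by its density matrix in the fixed
reference basis: a positive semidefinite complex matrix of trace one. -/
def IsState {d : ℕ} (ρ : Matrix (Fin d) (Fin d) ℂ) : Prop :=
  ρ.PosSemidef ∧ ρ.trace = 1

/-- The set of real states: states all of whose entries in the reference basis are real. -/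
def realStates (d : ℕ) : Set (Matrix (Fin d) (Fin d) ℂ) :=
  {σ | IsState σ ∧ ∀ i j, (σ i j).im = 0}

/-- The entrywise complex conjugate `ρ^*` in the reference basis (no transposition). -/
def conj {d : ℕ} (ρ : Matrix (Fin d) (Fin d) ℂ) : Matrix (Fin d) (Fin d) ℂ :=
  ρ.map (starRingEnd ℂ)

/-- The real part state `Re(ρ) = (ρ + ρ^*) / 2`. -/
def rePart {d : ℕ} (ρ : Matrix (Fin d) (Fin d) ℂ) : Matrix (Fin d) (Fin d) ℂ :=
  (1 / 2 : ℂ) • (ρ + conj ρ)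

/-- The trace norm `‖A‖_tr = Tr √(A† A)`; the trace is that of a positive semidefinite matrix,
hence a real number. -/
def traceNorm {d : ℕ} (A : Matrix (Fin d) (Fin d) ℂ) : ℝ :=
  (CFC.sqrt (Aᴴ * A)).trace.re

/-- The fidelity `F(ρ, σ) = Tr √(√ρ σ √ρ)`. -/
def fidelity {d : ℕ} (ρ σ : Matrix (Fin d) (Fin d) ℂ) : ℝ :=
  (CFC.sqrt (CFC.sqrt ρ * σ * CFC.sqrt ρ)).trace.re

/-- The purity `P(ρ) = Tr(ρ²)`, a real number for Hermitian `ρ`. -/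
def purity {d : ℕ} (ρ : Matrix (Fin d) (Fin d) ℂ) : ℝ :=
  (ρ * ρ).trace.re

/-- The trace norm imaginarity: the trace-norm distance of `ρ` to the set of real states. -/
def Mtr {d : ℕ} (ρ : Matrix (Fin d) (Fin d) ℂ) : ℝ :=
  sInf ((fun σ => traceNorm (ρ - σ)) '' realStates d)

/-- The imaginarity measure `M_Re(ρ) = 1 - F(ρ, Re(ρ))`. -/
def MRe {d : ℕ} (ρ : Matrix (Fin d) (Fin d) ℂ) : ℝ :=
  1 - fidelity ρ (rePart ρ)

end Imaginarity

end

noncomputable section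

namespace Imaginarity

open scoped ComplexOrder MatrixOrder Matrix

variable {d : ℕ}

local notation "Mat" d => Matrix (Fin d) (Fin d) ℂ

/-! Write A = Re ρ and H = ρ - A. Averaging over complex conjugation shows that A is a closest real
state, so M_tr = ‖H‖_tr (`Mtr_eq`). Conjugation fixes A and negates H, hence Tr ρA = Tr A² =: a and
P = a + b with b = Tr H² (`trace_mul_rePart`).

With `pairTrace` = 2e₂ of the eigenvalues, F² - Tr ρA = 2e₂(√(√ρ A √ρ)) ≥ 0. So F² ≥ a = P - b ≥ P -
M_tr², the upper bound on M_Re.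

For the lower bound, Cauchy-Schwarz on 2×2 minors gives F² ≤ a + √((1 - P)(1 - a))
(`fidelity_sq_le`). Then a ≥ 1/d and M_tr² ≤ d·b reduce the claim to the scalar inequality
`concave_bound`. -/

theorem sqrt_posSemidef (A : Mat d) : (CFC.sqrt A).PosSemidef :=
  Matrix.nonneg_iff_posSemidef.1 (CFC.sqrt_nonneg A)

theorem sqrt_isHermitian (A : Mat d) : (CFC.sqrt A)ᴴ = CFC.sqrt A :=
  (sqrt_posSemidef A).1

theorem sqrt_mul_sqrt {A : Mat d} (hA : A.PosSemidef) : CFC.sqrt A * CFC.sqrt A = A :=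
  CFC.sqrt_mul_sqrt_self A hA.nonneg

theorem trace_mul_nonneg {A B : Mat d} (hA : A.PosSemidef) (hB : B.PosSemidef) :
    0 ≤ (A * B).trace.re := by
  have h : (CFC.sqrt A * B * (CFC.sqrt A)ᴴ).PosSemidef := hB.mul_mul_conjTranspose_same _
  have h2 := (Complex.le_def.1 h.trace_nonneg).1
  rwa [sqrt_isHermitian, Matrix.trace_mul_comm, ← mul_assoc, sqrt_mul_sqrt hA] at h2

section frobenius

attribute [local instance] Matrix.frobeniusNormedAddCommGroup Matrix.frobeniusNormedRing

theorem frobenius_norm_sq (A : Mat d) : ‖A‖ ^ 2 = (Aᴴ * A).trace.re := by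
  rw [Matrix.frobenius_norm_def, ← Real.rpow_natCast, ← Real.rpow_mul (by positivity)]
  simp only [Matrix.trace, Matrix.diag, Matrix.mul_apply, Complex.re_sum]
  norm_num
  rw [Finset.sum_comm]
  refine Finset.sum_congr rfl fun i _ => Finset.sum_congr rfl fun j _ => ?_
  rw [← Complex.normSq_eq_norm_sq, Complex.normSq_apply]

/-- Submultiplicativity of the Frobenius norm for √A √B, whose squared norm is Tr AB. -/
theorem trace_mul_le {A B : Mat d} (hA : A.PosSemidef) (hB : B.PosSemidef) :
    (A * B).trace.re ≤ A.trace.re * B.trace.re := by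
  have h := Matrix.frobenius_norm_mul (CFC.sqrt A) (CFC.sqrt B)
  have h2 : ‖CFC.sqrt A * CFC.sqrt B‖ ^ 2 ≤ ‖CFC.sqrt A‖ ^ 2 * ‖CFC.sqrt B‖ ^ 2 := by
    rw [← mul_pow]; gcongr
  simp only [frobenius_norm_sq, Matrix.conjTranspose_mul, sqrt_isHermitian] at h2
  rw [sqrt_mul_sqrt hA, sqrt_mul_sqrt hB, mul_assoc, ← mul_assoc (CFC.sqrt A), sqrt_mul_sqrt hA,
    Matrix.trace_mul_comm, mul_assoc, sqrt_mul_sqrt hB] at h2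
  exact h2

end frobenius

/-! ### Second elementary symmetric function and 2×2 minors -/

/-- Twice the second elementary symmetric function of the eigenvalues (for Hermitian `A`). -/
def pairTrace (A : Mat d) : ℝ := A.trace.re ^ 2 - (A * A).trace.re

theorem pairTrace_nonneg {A : Mat d} (hA : A.PosSemidef) : 0 ≤ pairTrace A := by
  have := trace_mul_le hA hA
  unfold pairTrace; nlinarith

/-- With B = A + H the increment is 2(Tr A Tr H - Tr AH) + `pairTrace H`, and both terms are
nonnegative. -/
theorem pairTrace_mono {A B : Mat d} (hA : A.PosSemidef) (hAB : (B - A).PosSemidef) :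
    pairTrace A ≤ pairTrace B := by
  obtain ⟨H, rfl⟩ : ∃ H, B = A + H := ⟨B - A, by abel⟩
  rw [add_sub_cancel_left] at hAB
  have h1 := trace_mul_le hA hAB
  have h2 := trace_mul_le hAB hAB
  have h3 : (H * A).trace = (A * H).trace := Matrix.trace_mul_comm _ _
  simp only [pairTrace, add_mul, mul_add, Matrix.trace_add, h3, Complex.add_re]
  nlinarith

/-- The eigenvalues have nonnegative variance: Tr (A - t)² ≥ 0 for their mean t. -/
theorem sq_trace_le {A : Mat d} (hA : A.IsHermitian) :
    A.trace.re ^ 2 ≤ d * (A * A).trace.re := by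
  rcases Nat.eq_zero_or_pos d with rfl | hd
  · simp [Matrix.trace]
  have hd' : (0 : ℝ) < d := by exact_mod_cast hd
  set t : ℝ := A.trace.re / d with ht
  have ht2 : A.trace.re = t * d := by rw [ht]; field_simp
  have hB : (A - (t : ℂ) • 1)ᴴ = A - (t : ℂ) • 1 := by
    simp [Matrix.conjTranspose_sub, Matrix.conjTranspose_smul, hA.eq]
  have h := (Complex.le_def.1
    (Matrix.posSemidef_conjTranspose_mul_self (A - (t : ℂ) • (1 : Mat d))).trace_nonneg).1
  rw [hB] at h
  simp [sub_mul, mul_sub, Matrix.trace_sub, Matrix.trace_smul, Matrix.trace_one] at h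
  rw [ht2] at h ⊢
  nlinarith

/-- The minors form of `pairTrace` for a product. -/
theorem sum_minors_mul {R : Type*} [CommRing R] {n : Type*} [Fintype n] (C D : Matrix n n R) :
    ∑ p : (n × n) × (n × n),
      (C p.1.1 p.2.1 * C p.1.2 p.2.2 - C p.1.1 p.2.2 * C p.1.2 p.2.1) *
      (D p.2.1 p.1.1 * D p.2.2 p.1.2 - D p.2.2 p.1.1 * D p.2.1 p.1.2) =
    2 * ((C * D).trace ^ 2 - (C * D * (C * D)).trace) := by
  have key : ∀ i j : n, ∑ q : n × n,
      (C i q.1 * C j q.2 - C i q.2 * C j q.1) * (D q.1 i * D q.2 j - D q.2 i * D q.1 j) =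
      2 * ((C * D) i i * (C * D) j j - (C * D) i j * (C * D) j i) := by
    intro i j
    rw [Fintype.sum_prod_type]
    have e1 : (C * D) i i * (C * D) j j = ∑ k, ∑ l, C i k * D k i * (C j l * D l j) := by
      rw [Matrix.mul_apply, Matrix.mul_apply, Finset.sum_mul_sum]
    -- Each product is needed with both labellings of k and l: the four terms in the expanded
    -- product of minors pair up under k ↔ l, which produces the factor 2.
    have e1' : (C * D) i i * (C * D) j j = ∑ k, ∑ l, C i l * D l i * (C j k * D k j) := by
      rw [e1, Finset.sum_comm]
    have e2 : (C * D) i j * (C * D) j i = ∑ k, ∑ l, C i k * D k j * (C j l * D l i) := by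
      rw [Matrix.mul_apply, Matrix.mul_apply, Finset.sum_mul_sum]
    have e2' : (C * D) i j * (C * D) j i = ∑ k, ∑ l, C i l * D l j * (C j k * D k i) := by
      rw [e2, Finset.sum_comm]
    rw [two_mul, add_sub_assoc', sub_add_eq_add_sub]
    nth_rw 1 [e1, e1', e2, e2']
    simp only [← Finset.sum_add_distrib, ← Finset.sum_sub_distrib]
    refine Finset.sum_congr rfl fun k _ => Finset.sum_congr rfl fun l _ => ?_
    ring
  rw [Fintype.sum_prod_type, Fintype.sum_prod_type]
  simp only [key, ← Finset.mul_sum, Finset.sum_sub_distrib]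
  congr 2
  · rw [sq, Matrix.trace, Finset.sum_mul_sum]; simp only [Finset.mul_sum, Matrix.diag]

theorem sum_normSq_minors (C : Mat d) :
    ∑ p : (Fin d × Fin d) × (Fin d × Fin d),
      ‖C p.1.1 p.2.1 * C p.1.2 p.2.2 - C p.1.1 p.2.2 * C p.1.2 p.2.1‖ ^ 2 =
    2 * pairTrace (Cᴴ * C) := by
  have h := sum_minors_mul C Cᴴ
  have h1 : ∀ i j k l, (C i k * C j l - C i l * C j k) *
      (Cᴴ k i * Cᴴ l j - Cᴴ l i * Cᴴ k j) =
      ((‖C i k * C j l - C i l * C j k‖ ^ 2 : ℝ) : ℂ) := by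
    intro i j k l
    push_cast
    rw [← Complex.mul_conj']
    simp [Matrix.conjTranspose_apply]
  simp only [h1] at h
  have h2 := congrArg Complex.re h
  rw [← Complex.ofReal_sum, Complex.ofReal_re] at h2
  have h3 : (C * Cᴴ).trace.im = 0 :=
    ((Complex.le_def.1 (Matrix.posSemidef_self_mul_conjTranspose C).trace_nonneg).2).symm
  have h4 : (C * Cᴴ * (C * Cᴴ)).trace = (Cᴴ * C * (Cᴴ * C)).trace := by
    rw [mul_assoc, Matrix.trace_mul_comm]; simp only [mul_assoc]
  rw [h2, pairTrace, ← h4, Matrix.trace_mul_comm Cᴴ C]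
  simp [sq, h3]

/-- Cauchy-Schwarz on the second exterior power. -/
theorem norm_pairTrace_mul_le (C D : Mat d) :
    ‖(C * D).trace ^ 2 - (C * D * (C * D)).trace‖ ^ 2 ≤
      pairTrace (Cᴴ * C) * pairTrace (Dᴴ * D) := by
  have h := congrArg (fun z => ‖z‖) (sum_minors_mul C D)
  simp only [norm_mul, Complex.norm_ofNat] at h
  have hD := sum_normSq_minors D
  rw [← (Equiv.prodComm (Fin d × Fin d) (Fin d × Fin d)).sum_comp] at hD
  have h1 := norm_sum_le Finset.univ (fun p : (Fin d × Fin d) × (Fin d × Fin d) =>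
      (C p.1.1 p.2.1 * C p.1.2 p.2.2 - C p.1.1 p.2.2 * C p.1.2 p.2.1) *
      (D p.2.1 p.1.1 * D p.2.2 p.1.2 - D p.2.2 p.1.1 * D p.2.1 p.1.2))
  simp only [norm_mul] at h1
  have h2 := Finset.sum_mul_sq_le_sq_mul_sq Finset.univ
    (fun p : (Fin d × Fin d) × (Fin d × Fin d) =>
      ‖C p.1.1 p.2.1 * C p.1.2 p.2.2 - C p.1.1 p.2.2 * C p.1.2 p.2.1‖)
    (fun p => ‖D p.2.1 p.1.1 * D p.2.2 p.1.2 - D p.2.2 p.1.1 * D p.2.1 p.1.2‖)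
  rw [sum_normSq_minors] at h2
  have hD' : ∑ p : (Fin d × Fin d) × (Fin d × Fin d),
      ‖D p.2.1 p.1.1 * D p.2.2 p.1.2 - D p.2.2 p.1.1 * D p.2.1 p.1.2‖ ^ 2 =
      2 * pairTrace (Dᴴ * D) := by
    rw [← hD]
    refine Finset.sum_congr rfl fun p _ => ?_
    simp only [Equiv.prodComm_apply, Prod.fst_swap, Prod.snd_swap]
    congr 2; ring
  rw [hD'] at h2
  rw [h] at h1
  have h3 := (pow_le_pow_left₀ (by positivity) h1 2).trans h2
  nlinarith

/-- One half of the polar decomposition: `√(Kᴴ K) = T K` with `T` a partial isometry. -/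
theorem exists_polar (K : Mat d) : ∃ T : Mat d, T * K = CFC.sqrt (Kᴴ * K) ∧
    (1 - Tᴴ * T).PosSemidef := by
  set X := Kᴴ * K with hX
  have hpos : X.PosSemidef := Matrix.posSemidef_conjTranspose_mul_self K
  have hsa : IsSelfAdjoint X := hpos.1
  have hc : ∀ f : ℝ → ℝ, ContinuousOn f (spectrum ℝ X) := fun f =>
    X.finite_real_spectrum.continuousOn f
  -- Q is the pseudo-inverse of √X: the convention 0⁻¹ = 0 makes it vanish on the kernel of X.
  set Q : Mat d := cfc (fun x : ℝ => (Real.sqrt x)⁻¹) X with hQ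
  have hQh : Qᴴ = Q := (cfc_predicate (R := ℝ) (fun x : ℝ => (Real.sqrt x)⁻¹) X : IsSelfAdjoint Q)
  have hsp : ∀ x ∈ spectrum ℝ X, 0 ≤ x := fun x hx => spectrum_nonneg_of_nonneg hpos.nonneg hx
  have hid : cfc (fun x : ℝ => x) X = X := cfc_id' ℝ X
  have hQX : Q * X = cfc (fun x : ℝ => (Real.sqrt x)⁻¹ * x) X := by
    rw [cfc_mul _ _ X (hc _) (hc _), hid]
  have h1 : Q * X = CFC.sqrt X := by
    rw [hQX]
    refine (CFC.sqrt_unique ?_ (cfc_nonneg fun x hx => ?_)).symm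
    · rw [← cfc_mul _ _ X (hc _) (hc _)]
      refine Eq.trans (cfc_congr fun x hx => ?_) hid
      have hx0 := hsp x hx
      rcases hx0.eq_or_lt with rfl | h0
      · simp
      · have h00 := (Real.sqrt_pos.2 h0).ne'
        have := Real.sq_sqrt hx0
        field_simp
        rw [this]
    · exact mul_nonneg (by positivity) (hsp x hx)
  have h2 : Q * Q * X * (Q * Q) = Q * Q := by
    rw [mul_assoc Q Q X, hQX, hQ, ← cfc_mul _ _ X (hc _) (hc _), ← cfc_mul _ _ X (hc _) (hc _),
      ← cfc_mul _ _ X (hc _) (hc _)]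
    refine cfc_congr fun x hx => ?_
    have hx0 := hsp x hx
    rcases hx0.eq_or_lt with rfl | h0
    · simp
    · have h00 := (Real.sqrt_pos.2 h0).ne'
      have := Real.sq_sqrt hx0
      field_simp
      rw [this]
  refine ⟨Q * Kᴴ, by rw [mul_assoc, ← hX, h1], ?_⟩
  have hT : (Q * Kᴴ)ᴴ * (Q * Kᴴ) = K * (Q * Q) * Kᴴ := by
    rw [Matrix.conjTranspose_mul, hQh, Matrix.conjTranspose_conjTranspose]; simp only [mul_assoc]
  rw [hT]
  set P := K * (Q * Q) * Kᴴ with hP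
  have hPh : Pᴴ = P := by
    simp only [hP, Matrix.conjTranspose_mul, hQh, Matrix.conjTranspose_conjTranspose, mul_assoc]
  have hPP : P * P = P := by
    calc P * P = K * (Q * Q * (Kᴴ * K) * (Q * Q)) * Kᴴ := by simp only [hP, mul_assoc]
      _ = P := by rw [← hX, h2]
  have h3 : (1 - P)ᴴ * (1 - P) = 1 - P := by
    rw [Matrix.conjTranspose_sub, hPh, Matrix.conjTranspose_one, sub_mul, mul_sub, mul_sub, hPP]
    simp
  rw [← h3]
  exact Matrix.posSemidef_conjTranspose_mul_self _

/-! ### Fidelity bounds -/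

theorem sqrt_mul_conjTranspose_self (ρ σ : Mat d) (hσ : σ.PosSemidef) :
    CFC.sqrt ρ * σ * CFC.sqrt ρ =
      (CFC.sqrt σ * CFC.sqrt ρ)ᴴ * (CFC.sqrt σ * CFC.sqrt ρ) := by
  rw [Matrix.conjTranspose_mul, sqrt_isHermitian, sqrt_isHermitian]
  nth_rw 1 [← sqrt_mul_sqrt hσ]
  simp only [mul_assoc]

theorem fidelity_sq_sub {ρ σ : Mat d} (hρ : ρ.PosSemidef) (hσ : σ.PosSemidef) :
    fidelity ρ σ ^ 2 - (ρ * σ).trace.re =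
      pairTrace (CFC.sqrt (CFC.sqrt ρ * σ * CFC.sqrt ρ)) := by
  have hX : (CFC.sqrt ρ * σ * CFC.sqrt ρ).PosSemidef := by
    rw [sqrt_mul_conjTranspose_self ρ σ hσ]; exact Matrix.posSemidef_conjTranspose_mul_self _
  have h : (CFC.sqrt ρ * σ * CFC.sqrt ρ).trace = (ρ * σ).trace := by
    rw [Matrix.trace_mul_comm, ← mul_assoc, sqrt_mul_sqrt hρ]
  rw [pairTrace, sqrt_mul_sqrt hX, fidelity, h]

theorem fidelity_nonneg (ρ σ : Mat d) : 0 ≤ fidelity ρ σ :=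
  (Complex.le_def.1 (sqrt_posSemidef _).trace_nonneg).1

theorem trace_mul_le_fidelity_sq {ρ σ : Mat d} (hρ : ρ.PosSemidef) (hσ : σ.PosSemidef) :
    (ρ * σ).trace.re ≤ fidelity ρ σ ^ 2 := by
  have h := fidelity_sq_sub hρ hσ
  have := pairTrace_nonneg (sqrt_posSemidef (CFC.sqrt ρ * σ * CFC.sqrt ρ))
  linarith

/-- Fidelity is bounded by super-fidelity. -/
theorem fidelity_sq_le {ρ σ : Mat d} (hρ : ρ.PosSemidef) (hσ : σ.PosSemidef) :
    fidelity ρ σ ^ 2 ≤ (ρ * σ).trace.re + Real.sqrt (pairTrace ρ * pairTrace σ) := by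
  have h := fidelity_sq_sub hρ hσ
  obtain ⟨T, hT, hT1⟩ := exists_polar (CFC.sqrt σ * CFC.sqrt ρ)
  rw [sqrt_mul_conjTranspose_self ρ σ hσ, ← hT, ← mul_assoc] at h
  have hle := norm_pairTrace_mul_le (T * CFC.sqrt σ) (CFC.sqrt ρ)
  set Y := T * CFC.sqrt σ * CFC.sqrt ρ with hY
  have hYpos : Y.PosSemidef := by
    rw [hY, mul_assoc, hT]; exact (sqrt_posSemidef _)
  have him : Y.trace.im = 0 := ((Complex.le_def.1 hYpos.trace_nonneg).2).symm
  have h1 : pairTrace Y ≤ ‖Y.trace ^ 2 - (Y * Y).trace‖ := by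
    refine le_trans (le_of_eq ?_) (Complex.re_le_norm _)
    simp [pairTrace, sq, him]
  have h2 : pairTrace ((T * CFC.sqrt σ)ᴴ * (T * CFC.sqrt σ)) ≤ pairTrace σ := by
    refine pairTrace_mono (Matrix.posSemidef_conjTranspose_mul_self _) ?_
    -- σ - (T√σ)ᴴ(T√σ) = √σ (1 - TᴴT) √σ ≥ 0.
    have := hT1.mul_mul_conjTranspose_same (CFC.sqrt σ)
    rw [sqrt_isHermitian] at this
    convert this using 1
    rw [Matrix.conjTranspose_mul, sqrt_isHermitian, mul_sub, sub_mul, mul_one, sqrt_mul_sqrt hσ]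
    simp only [mul_assoc]
  rw [sqrt_isHermitian, sqrt_mul_sqrt hρ] at hle
  have h3 : ‖Y.trace ^ 2 - (Y * Y).trace‖ ≤ Real.sqrt (pairTrace ρ * pairTrace σ) := by
    refine Real.le_sqrt_of_sq_le (hle.trans ?_)
    rw [mul_comm]
    exact mul_le_mul_of_nonneg_left h2 (pairTrace_nonneg hρ)
  linarith

/-! ### Trace norm: comparison with Tr H² and duality -/

theorem sq_traceNorm_le {H : Mat d} (hH : H.IsHermitian) :
    traceNorm H ^ 2 ≤ d * (H * H).trace.re := by
  have h := sq_trace_le (sqrt_isHermitian (Hᴴ * H))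
  rw [sqrt_mul_sqrt (Matrix.posSemidef_conjTranspose_mul_self H)] at h
  nth_rw 2 [hH.eq] at h
  exact h

theorem trace_sq_le_sq_traceNorm {H : Mat d} (hH : H.IsHermitian) :
    (H * H).trace.re ≤ traceNorm H ^ 2 := by
  have h := pairTrace_nonneg (sqrt_posSemidef (Hᴴ * H))
  rw [pairTrace, sqrt_mul_sqrt (Matrix.posSemidef_conjTranspose_mul_self H)] at h
  nth_rw 2 [hH.eq] at h
  exact sub_nonneg.1 h

/-- Duality bound of the trace norm of a Hermitian matrix by a Hermitian contraction. -/
theorem trace_mul_le_traceNorm {S H : Mat d} (hH : H.IsHermitian) (h1 : (1 - S).PosSemidef)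
    (h2 : (1 + S).PosSemidef) : (S * H).trace.re ≤ traceNorm H := by
  have hsa : IsSelfAdjoint H := hH
  have hp : (H⁺).PosSemidef := Matrix.nonneg_iff_posSemidef.1 (CFC.posPart_nonneg H)
  have hn : (H⁻).PosSemidef := Matrix.nonneg_iff_posSemidef.1 (CFC.negPart_nonneg H)
  have e1 : H = H⁺ - H⁻ := (CFC.posPart_sub_negPart H hsa).symm
  have e2 : CFC.abs H = H⁺ + H⁻ := (CFC.posPart_add_negPart H hsa).symm
  have h3 := trace_mul_nonneg h1 hp
  have h4 := trace_mul_nonneg h2 hn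
  have h5 : traceNorm H = (H⁺ + H⁻).trace.re := by rw [← e2]; rfl
  rw [h5]
  nth_rw 1 [e1]
  simp only [sub_mul, add_mul, mul_sub, one_mul, Matrix.trace_add, Matrix.trace_sub,
    Complex.add_re, Complex.sub_re] at *
  linarith

/-- The sign function of H attains the duality bound; its value at 0 only has to lie in [-1, 1]. -/
theorem exists_sign {H : Mat d} (hH : H.IsHermitian) : ∃ S : Mat d, (1 - S).PosSemidef ∧
    (1 + S).PosSemidef ∧ (S * H).trace.re = traceNorm H := by
  have hsa : IsSelfAdjoint H := hH
  have hc : ∀ f : ℝ → ℝ, ContinuousOn f (spectrum ℝ H) := fun f =>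
    H.finite_real_spectrum.continuousOn f
  have hid : cfc (fun x : ℝ => x) H = H := cfc_id' ℝ H
  have h1 : cfc (fun _ : ℝ => (1 : ℝ)) H = 1 := cfc_const_one ℝ H
  refine ⟨cfc (fun x : ℝ => if 0 ≤ x then 1 else -1) H, ?_, ?_, ?_⟩
  · rw [← h1, ← cfc_sub _ _ H (hc _) (hc _), ← Matrix.nonneg_iff_posSemidef]
    refine cfc_nonneg fun x _ => ?_
    split_ifs <;> norm_num
  · rw [← h1, ← cfc_add H _ _ (hc _) (hc _), ← Matrix.nonneg_iff_posSemidef]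
    refine cfc_nonneg fun x _ => ?_
    split_ifs <;> norm_num
  · nth_rw 2 [← hid]
    rw [← cfc_mul _ _ H (hc _) (hc _)]
    change _ = (CFC.abs H).trace.re
    rw [CFC.abs_eq_cfc_norm H hsa]
    congr 2
    refine cfc_congr fun x _ => ?_
    simp only [Real.norm_eq_abs]
    split_ifs with h
    · rw [abs_of_nonneg h, one_mul]
    · rw [abs_of_neg (not_le.1 h)]; ring

/-! ### Conjugation and the closest real state -/

theorem conj_eq_transpose {A : Mat d} (hA : A.IsHermitian) : conj A = Aᵀ := by
  ext i j
  rw [conj, Matrix.map_apply, Matrix.transpose_apply]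
  exact hA.apply j i

theorem conj_mul (A B : Mat d) : conj (A * B) = conj A * conj B :=
  Matrix.map_mul

theorem conj_conj (A : Mat d) : conj (conj A) = A := by
  ext i j; simp [conj]

theorem trace_conj (A : Mat d) : (conj A).trace = (starRingEnd ℂ) A.trace := by
  simp [conj, Matrix.trace]

theorem conj_sub (A B : Mat d) : conj (A - B) = conj A - conj B := by
  ext i j; simp [conj]

theorem conj_add (A B : Mat d) : conj (A + B) = conj A + conj B := by
  ext i j; simp [conj]

theorem conj_one : conj (1 : Mat d) = 1 := by
  ext i j; by_cases h : i = j <;> simp [conj, Matrix.one_apply, h]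

theorem conj_posSemidef {A : Mat d} (hA : A.PosSemidef) : (conj A).PosSemidef := by
  rw [conj_eq_transpose hA.1]; exact hA.transpose

theorem rePart_isState {ρ : Mat d} (hρ : IsState ρ) : IsState (rePart ρ) := by
  refine ⟨?_, ?_⟩
  · exact (hρ.1.add (conj_posSemidef hρ.1)).smul
      (by simp)
  · rw [rePart, Matrix.trace_smul, Matrix.trace_add, trace_conj, hρ.2]; norm_num

theorem rePart_mem_realStates {ρ : Mat d} (hρ : IsState ρ) : rePart ρ ∈ realStates d := by
  refine ⟨rePart_isState hρ, fun i j => ?_⟩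
  simp [rePart, conj]

theorem sub_rePart (ρ : Mat d) : ρ - rePart ρ = (1 / 2 : ℂ) • (ρ - conj ρ) := by
  rw [rePart]; module

theorem conj_of_mem_realStates {σ : Mat d} (hσ : σ ∈ realStates d) : conj σ = σ := by
  ext i j; exact Complex.conj_eq_iff_im.2 (hσ.2 i j)

/-- If S is optimal for ρ - Re ρ, then -S* is also a contraction. Testing ρ - σ against both and
adding cancels the real σ and leaves 2 Tr S(ρ - Re ρ). -/
theorem traceNorm_sub_rePart_le {ρ σ : Mat d} (hρ : IsState ρ) (hσ : σ ∈ realStates d) :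
    traceNorm (ρ - rePart ρ) ≤ traceNorm (ρ - σ) := by
  obtain ⟨S, hS1, hS2, hS⟩ := exists_sign (hρ.1.1.sub (rePart_isState hρ).1.1)
  have hd : (ρ - σ).IsHermitian := hρ.1.1.sub hσ.1.1.1
  have h1 := trace_mul_le_traceNorm hd hS1 hS2
  have h2 := trace_mul_le_traceNorm (S := -conj S) hd
    (by rw [sub_neg_eq_add, ← conj_one, ← conj_add]; exact conj_posSemidef hS2)
    (by rw [← sub_eq_add_neg, ← conj_one, ← conj_sub]; exact conj_posSemidef hS1)
  have h3 : (-conj S * (ρ - σ)).trace.re = -(S * (conj ρ - σ)).trace.re := by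
    have : conj S * (ρ - σ) = conj (S * (conj ρ - σ)) := by
      rw [conj_mul, conj_sub, conj_conj, conj_of_mem_realStates hσ]
    rw [neg_mul, Matrix.trace_neg, this, trace_conj, Complex.neg_re, Complex.conj_re]
  have h4 : (2 : ℂ) • (S * (ρ - rePart ρ)) = S * (ρ - σ) - S * (conj ρ - σ) := by
    rw [← mul_sub, sub_rePart, Matrix.mul_smul, smul_smul]; norm_num
  have h5 := congrArg (fun A => A.trace.re) h4
  simp only [Matrix.trace_smul, Matrix.trace_sub, Complex.sub_re, smul_eq_mul, Complex.mul_re,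
    Complex.re_ofNat, Complex.im_ofNat] at h5
  rw [h3] at h2
  linarith

theorem Mtr_eq {ρ : Mat d} (hρ : IsState ρ) : Mtr ρ = traceNorm (ρ - rePart ρ) := by
  refine IsLeast.csInf_eq ⟨⟨_, rePart_mem_realStates hρ, rfl⟩, ?_⟩
  rintro _ ⟨σ, hσ, rfl⟩
  exact traceNorm_sub_rePart_le hρ hσ

theorem trace_mul_rePart (ρ : Mat d) :
    (ρ * rePart ρ).trace.re = (rePart ρ * rePart ρ).trace.re ∧
    purity ρ = (rePart ρ * rePart ρ).trace.re +
      ((ρ - rePart ρ) * (ρ - rePart ρ)).trace.re := by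
  have h1 : (conj ρ * conj ρ).trace.re = (ρ * ρ).trace.re := by
    rw [← conj_mul, trace_conj, Complex.conj_re]
  have h2 : (conj ρ * ρ).trace = (ρ * conj ρ).trace := Matrix.trace_mul_comm _ _
  rw [sub_rePart, rePart, purity]
  constructor <;>
  · simp [mul_add, add_mul, mul_sub, sub_mul, Matrix.trace_add, Matrix.trace_sub, h1, h2,
      Matrix.trace_smul]
    ring

/-- Here n = d, a = Tr A², b = Tr H², M = M_tr. -/
theorem concave_bound {n a b M : ℝ} (hn : 1 ≤ n) (ha : 1 ≤ n * a) (hb : M ^ 2 ≤ n * b)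
    (hab : a + b ≤ 1) (hb0 : 0 ≤ b) :
    0 ≤ (n - 1) ^ 2 - (n - 1) * M ^ 2 ∧
    a + Real.sqrt ((1 - (a + b)) * (1 - a)) ≤
      1 / n + 1 / n * Real.sqrt ((n - 1) ^ 2 - (n - 1) * M ^ 2) := by
  have hn0 : 0 < n := by linarith
  have hM : M ^ 2 ≤ n - 1 := by nlinarith
  have h0 : 0 ≤ (n - 1) ^ 2 - (n - 1) * M ^ 2 := by nlinarith
  refine ⟨h0, ?_⟩
  set s := Real.sqrt ((1 - (a + b)) * (1 - a)) with hs
  have hs0 : 0 ≤ s := Real.sqrt_nonneg _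
  have hsq : s ^ 2 = (1 - (a + b)) * (1 - a) := Real.sq_sqrt (by nlinarith)
  -- AM-GM for the two factors. Used in the cross term of (na - 1 + ns)², it makes a cancel, leaving
  -- exactly (n - 1)² - (n - 1)nb.
  have hsle : s ≤ (1 - a) - b / 2 := by
    apply abs_le_of_sq_le_sq' _ (by linarith) |>.2
    nlinarith [sq_nonneg b]
  suffices h : n * a - 1 + n * s ≤ Real.sqrt ((n - 1) ^ 2 - (n - 1) * M ^ 2) by
    rw [← mul_le_mul_iff_of_pos_left hn0]
    have : n * (1 / n + 1 / n * Real.sqrt ((n - 1) ^ 2 - (n - 1) * M ^ 2)) =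
      1 + Real.sqrt ((n - 1) ^ 2 - (n - 1) * M ^ 2) := by field_simp
    rw [this]; linarith
  apply Real.le_sqrt_of_sq_le
  have hδ : 0 ≤ n * a - 1 := by linarith
  have h1 : (n * a - 1) * (n * s) ≤ (n * a - 1) * (n * ((1 - a) - b / 2)) := by gcongr
  have h2 : (n - 1) * M ^ 2 ≤ (n - 1) * (n * b) :=
    mul_le_mul_of_nonneg_left hb (by linarith)
  have h3 : (n * s) ^ 2 = n ^ 2 * ((1 - (a + b)) * (1 - a)) := by rw [mul_pow, hsq]
  nlinarith

end Imaginarity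

end

theorem theorem6 (d : ℕ) (ρ : Matrix (Fin d) (Fin d) ℂ) (hρ : Imaginarity.IsState ρ) :
    0 ≤ ((d : ℝ) - 1) ^ 2 - ((d : ℝ) - 1) * Imaginarity.Mtr ρ ^ 2 ∧
    1 - Real.sqrt (1 / (d : ℝ) + 1 / (d : ℝ) *
        Real.sqrt (((d : ℝ) - 1) ^ 2 - ((d : ℝ) - 1) * Imaginarity.Mtr ρ ^ 2))
      ≤ Imaginarity.MRe ρ ∧
    Imaginarity.MRe ρ
      ≤ 1 - Real.sqrt (max 0 (Imaginarity.purity ρ - Imaginarity.Mtr ρ ^ 2)) := by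
  open Imaginarity in
  have hA := rePart_isState hρ
  have hH := hρ.1.1.sub hA.1.1
  obtain ⟨hρA, hP⟩ := trace_mul_rePart ρ
  have hd : (1 : ℝ) ≤ d := by
    rcases Nat.eq_zero_or_pos d with rfl | h
    · have := hρ.2; simp [Matrix.trace] at this
    · exact_mod_cast h
  have ha := sq_trace_le hA.1.1
  rw [hA.2, Complex.one_re, one_pow] at ha
  have hb := sq_traceNorm_le hH
  have hb' := trace_sq_le_sq_traceNorm hH
  have hpρ := pairTrace_nonneg hρ.1
  have heρ : pairTrace ρ = 1 - purity ρ := by simp [pairTrace, purity, hρ.2]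
  have heA : pairTrace (rePart ρ) = 1 - (rePart ρ * rePart ρ).trace.re := by
    simp [pairTrace, hA.2]
  rw [← Mtr_eq hρ] at hb hb'
  have hb0 : 0 ≤ ((ρ - rePart ρ) * (ρ - rePart ρ)).trace.re := by nlinarith [sq_nonneg (Mtr ρ)]
  obtain ⟨h0, h1⟩ := concave_bound hd ha hb (by linarith) hb0
  refine ⟨h0, ?_, ?_⟩
  · refine sub_le_sub_left (Real.le_sqrt_of_sq_le ?_) 1
    refine (fidelity_sq_le hρ.1 hA.1).trans ?_
    rwa [hρA, heρ, heA, hP]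
  · refine sub_le_sub_left ((Real.sqrt_le_left (fidelity_nonneg _ _)).2 ?_) 1
    refine max_le (sq_nonneg _) ?_
    have := trace_mul_le_fidelity_sq hρ.1 hA.1
    linarith
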